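/- Let $G$ be a compact Hausdorff topological group with trivial center. Let $\mathrm{Aut}(G)$ be the group of all topological automorphisms of $G$ (automorphisms that are homeomorphisms) with the compact-open topology; it is a topological group. Let $\mathrm{Inn}(G)\le\mathrm{Aut}(G)$ be the subgroup of inner automorphisms $\gamma_g\colon x\mapsto gxg^{-1}$, $g\in G$, and let $P\le\mathrm{Inn}(G)$ be an arbitrary (not necessarily closed) subgroup, with the subspace topology; let $\overline P$ be its closure in $\mathrm{Aut}(G)$. Let $G\rtimes P$ be the semidirect product for the natural action of $P$ on $G$, that is, $G\times P$ with the multiplication $(g,f)(g',f')=(g\,f(g'),\,f f')$ and the product topology. A Hausdorff topological group is called minimal if it admits no strictly coarser Hausdorff group topology. A subgroup $H$ of a topological group $A$ is called essential in $A$ if $H\cap N$ is nontrivial for every nontrivial closed normal subgroup $N$ of $A$. Theorem. The topological group $G\rtimes P$ is minimal if and only if $P$ is essential in $\overline P$. -/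

import Mathlib

open Topology

namespace TopAut

variable {G : Type*} [Group G] [TopologicalSpace G]

/-- The topological automorphisms of `G` form a group under composition:
`(f * g) x = f (g x)`. -/
instance instGroup : Group (G ≃ₜ* G) where
  mul f g := g.trans f
  one := ContinuousMulEquiv.refl G
  inv f := f.symm
  mul_assoc _ _ _ := rfl
  one_mul _ := rfl
  mul_one _ := rfl
  inv_mul_cancel f := ContinuousMulEquiv.ext fun x => f.symm_apply_apply x

theorem mul_apply (f g : G ≃ₜ* G) (x : G) : (f * g) x = f (g x) := rfl

theorem one_apply (x : G) : (1 : G ≃ₜ* G) x = x := rfl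

theorem inv_apply_eq_iff (f : G ≃ₜ* G) (x y : G) : f⁻¹ x = y ↔ f y = x :=
  ⟨fun h => h ▸ f.apply_symm_apply x, fun h => h ▸ f.symm_apply_apply y⟩

/-- The underlying continuous map of a topological automorphism. -/
def toCMap (f : G ≃ₜ* G) : C(G, G) := ⟨f, f.continuous_toFun⟩

/-- The compact-open topology on the group of topological automorphisms. -/
instance instTopologicalSpace : TopologicalSpace (G ≃ₜ* G) :=
  TopologicalSpace.induced toCMap ContinuousMap.compactOpen

theorem continuous_toCMap : Continuous (toCMap : (G ≃ₜ* G) → C(G, G)) :=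
  continuous_induced_dom

/-- For a compact Hausdorff group, the group of topological automorphisms is a topological group
in the compact-open topology. -/
instance instIsTopologicalGroup [CompactSpace G] [T2Space G] : IsTopologicalGroup (G ≃ₜ* G) where
  continuous_mul := by
    refine continuous_induced_rng.2 ?_
    exact ContinuousMap.continuous_comp'.comp
      ((continuous_toCMap.comp continuous_snd).prodMk (continuous_toCMap.comp continuous_fst))
  continuous_inv := by
    refine continuous_induced_rng.2 ?_
    refine ContinuousMap.continuous_of_continuous_uncurry _ ?_
    have hev : Continuous fun q : (G ≃ₜ* G) × G => q.1 q.2 :=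
      (continuous_eval (F := C(G, G))).comp
        ((continuous_toCMap.comp continuous_fst).prodMk continuous_snd)
    refine continuous_iff_isClosed.2 fun C hC => ?_
    have hcl : IsClosed {r : ((G ≃ₜ* G) × G) × G | r.1.1 r.2 = r.1.2 ∧ r.2 ∈ C} :=
      (isClosed_eq (hev.comp ((continuous_fst.comp continuous_fst).prodMk continuous_snd))
        (continuous_snd.comp continuous_fst)).inter (hC.preimage continuous_snd)
    convert isClosedMap_fst_of_compactSpace _ hcl using 1
    ext ⟨f, y⟩
    constructor
    · intro h
      exact ⟨((f, y), f⁻¹ y), ⟨(inv_apply_eq_iff f y _).1 rfl, h⟩, rfl⟩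
    · rintro ⟨⟨⟨g, z⟩, x⟩, ⟨h, hx⟩, hq⟩
      obtain ⟨rfl, rfl⟩ := Prod.mk.inj hq
      have hx' : g⁻¹ z = x := (inv_apply_eq_iff _ _ _).2 h
      change g⁻¹ z ∈ C
      rwa [hx']

/-- The homomorphism `Γ : G → Aut(G)`, where `Γ g` is the inner automorphism `x ↦ g x g⁻¹`. -/
def conj [IsTopologicalGroup G] : G →* (G ≃ₜ* G) where
  toFun g :=
    { MulAut.conj g with
      continuous_toFun := by
        change Continuous fun x : G => g * x * g⁻¹
        fun_prop
      continuous_invFun := by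
        change Continuous fun x : G => g⁻¹ * x * g
        fun_prop }
  map_one' := ContinuousMulEquiv.ext fun x => by
    change 1 * x * 1⁻¹ = x
    simp
  map_mul' g h := ContinuousMulEquiv.ext fun x => by
    change (g * h) * x * (g * h)⁻¹ = g * (h * x * h⁻¹) * g⁻¹
    simp [mul_assoc]

theorem conj_apply [IsTopologicalGroup G] (g x : G) : conj g x = g * x * g⁻¹ := rfl

variable (G) in
/-- The subgroup `Inn(G)` of inner automorphisms in `Aut(G)`. -/
def Inn [IsTopologicalGroup G] : Subgroup (G ≃ₜ* G) := (conj : G →* (G ≃ₜ* G)).range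

/-- The natural action by automorphisms on `G` of a subgroup `P` of `Aut(G)`. -/
def action (P : Subgroup (G ≃ₜ* G)) : P →* MulAut G where
  toFun f := (f : G ≃ₜ* G).toMulEquiv
  map_one' := rfl
  map_mul' _ _ := rfl

theorem action_apply (P : Subgroup (G ≃ₜ* G)) (f : P) (x : G) :
    action P f x = (f : G ≃ₜ* G) x := rfl

end TopAut

/-- The product topology on a semidirect product of topological groups. -/
instance SemidirectProduct.instTopologicalSpace {N H : Type*} [Group N] [Group H]
    [TopologicalSpace N] [TopologicalSpace H] (φ : H →* MulAut N) :
    TopologicalSpace (N ⋊[φ] H) :=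
  TopologicalSpace.induced (fun a => (a.left, a.right)) (inferInstance : TopologicalSpace (N × H))

/-- A minimal topological group: a Hausdorff topological group that admits no strictly coarser
Hausdorff group topology. In Mathlib's order on topologies, `τ ≤ σ` says that `σ` is coarser
than `τ`. -/
structure IsMinimalTopologicalGroup (A : Type*) [Group A] [τ : TopologicalSpace A] : Prop where
  isTopologicalGroup : IsTopologicalGroup A
  t2Space : T2Space A
  eq_of_coarser : ∀ σ : TopologicalSpace A, @IsTopologicalGroup A σ _ → @T2Space A σ →
    τ ≤ σ → σ = τ

/-- A subgroup `H` of a topological group `A` is essential in `A` if it meets every nontrivial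
closed normal subgroup of `A` nontrivially. -/
def Subgroup.IsEssential {A : Type*} [Group A] [TopologicalSpace A] (H : Subgroup A) : Prop :=
  ∀ N : Subgroup A, N.Normal → IsClosed (N : Set A) → N ≠ ⊥ → H ⊓ N ≠ ⊥

/-! Since `G` is compact and centerless, `conj` is a topological isomorphism of `G` onto `Inn G`,
which is therefore closed and contains the closure `Q` of `P`. Its inverse gives a continuous
homomorphism `s : Q →* G` such that `f` is conjugation by `s f`. The map `(g, f) ↦ (g * s f, f)`
then embeds `G ⋊ P` as the dense subgroup `G × P` of the compact group `G × Q`. A dense subgroup of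
a compact group is minimal iff it is essential (`isMinimalTopologicalGroup_iff_isEssential_range`),
and a centerless factor `G` does not affect essentiality (`Subgroup.isEssential_top_prod_iff`). -/

/-! ### Minimality of dense subgroups of compact groups. -/

section MinimalityCriterion

variable {H K : Type*} [Group H] [Group K] [TopologicalSpace K] [IsTopologicalGroup K]

/-- The intersection of the closures of the images of all identity neighbourhoods of `H`. -/
def MonoidHom.nhdsCore (σ : TopologicalSpace H) (hσ : @IsTopologicalGroup H σ _) (i : H →* K) :
    Subgroup K where
  carrier := {x | ∀ U ∈ @nhds H σ 1, x ∈ closure (i '' U)}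
  one_mem' U hU := subset_closure ⟨1, @mem_of_mem_nhds H σ _ _ hU, map_one i⟩
  mul_mem' {x y} hx hy U hU := by
    have hmul : Filter.Tendsto (fun p : H × H => p.1 * p.2) (@nhds H σ 1 ×ˢ @nhds H σ 1)
        (@nhds H σ 1) := by
      have h := (continuous_mul (M := H)).tendsto (1, 1)
      rwa [nhds_prod_eq, mul_one] at h
    obtain ⟨V, hV, W, hW, hVW⟩ := Filter.mem_prod_iff.1 (hmul hU)
    refine map_mem_closure₂ continuous_mul (hx V hV) (hy W hW) ?_
    rintro _ ⟨v, hv, rfl⟩ _ ⟨w, hw, rfl⟩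
    exact ⟨v * w, hVW (Set.mk_mem_prod hv hw), map_mul i v w⟩
  inv_mem' {x} hx U hU := by
    have hinv : Filter.Tendsto (fun h : H => h⁻¹) (@nhds H σ 1) (@nhds H σ 1) := by
      simpa using (continuous_inv (G := H)).tendsto 1
    refine map_mem_closure continuous_inv (hx _ (hinv hU)) ?_
    rintro _ ⟨v, hv, rfl⟩
    exact ⟨v⁻¹, hv, map_inv i v⟩

theorem MonoidHom.isClosed_nhdsCore (σ : TopologicalSpace H) (hσ : @IsTopologicalGroup H σ _)
    (i : H →* K) : IsClosed (i.nhdsCore σ hσ : Set K) := by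
  have : (i.nhdsCore σ hσ : Set K) = ⋂ U ∈ @nhds H σ 1, closure (i '' U) := by
    ext x
    simp only [Set.mem_iInter]
    rfl
  rw [this]
  exact isClosed_biInter fun _ _ => isClosed_closure

/-- Conjugation by `h : H` is continuous for `σ` and fixes `1`, so `i h` conjugates the core into
itself; density of `i` and closedness of the core extend this to all of `K`. -/
theorem MonoidHom.normal_nhdsCore (σ : TopologicalSpace H) (hσ : @IsTopologicalGroup H σ _)
    (i : H →* K) (hi : DenseRange i) : (i.nhdsCore σ hσ).Normal := by
  refine ⟨fun n hn k => ?_⟩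
  have hcl : IsClosed {k : K | k * n * k⁻¹ ∈ i.nhdsCore σ hσ} :=
    (i.isClosed_nhdsCore σ hσ).preimage (by fun_prop)
  refine hi.induction_on (p := fun k => k * n * k⁻¹ ∈ i.nhdsCore σ hσ) k hcl fun h U hU => ?_
  have hconj : Filter.Tendsto (fun x : H => h * x * h⁻¹) (@nhds H σ 1) (@nhds H σ 1) := by
    have hc : Continuous fun x : H => h * x * h⁻¹ := by fun_prop
    simpa using hc.tendsto 1
  refine map_mem_closure (f := fun x : K => i h * x * (i h)⁻¹) (by fun_prop)
    (hn _ (hconj hU)) ?_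
  rintro _ ⟨v, hv, rfl⟩
  exact ⟨h * v * h⁻¹, hv, by simp⟩

theorem exists_isClosed_mem_nhds_one_notMem [TopologicalSpace H] [IsTopologicalGroup H] [T2Space H]
    {h : H} (hh : h ≠ 1) : ∃ U ∈ 𝓝 (1 : H), IsClosed U ∧ h ∉ U := by
  obtain ⟨U, hU, hUc, hUs⟩ :=
    exists_mem_nhds_isClosed_subset (isOpen_compl_singleton.mem_nhds hh.symm)
  exact ⟨U, hU, hUc, fun hm => hUs hm rfl⟩

/-- A dense subgroup of a compact Hausdorff group is minimal if and only if it is essential. -/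
theorem isMinimalTopologicalGroup_iff_isEssential_range [CompactSpace K] [T2Space K]
    [τ : TopologicalSpace H] (i : H →* K) (hi : IsEmbedding i) (hd : DenseRange i) :
    IsMinimalTopologicalGroup H ↔ i.range.IsEssential := by
  have hH : IsTopologicalGroup H := hi.isInducing.topologicalGroup i
  constructor
  · rintro hmin N hN hNc hN1 hbot
    have : IsClosed (N : Set K) := hNc
    let q : H →* K ⧸ N := (QuotientGroup.mk' N).comp i
    have hq : Function.Injective q := by
      refine (injective_iff_map_eq_one q).2 fun h hh => ?_
      have hm : i h ∈ i.range ⊓ N := ⟨⟨h, rfl⟩, (QuotientGroup.eq_one_iff _).1 hh⟩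
      rw [hbot, Subgroup.mem_bot] at hm
      exact hi.injective (hm.trans (map_one i).symm)
    have hqc : Continuous q := continuous_quot_mk.comp hi.continuous
    -- Minimality makes the topology pulled back from `K ⧸ N` equal to `τ`.
    have hqe : τ = TopologicalSpace.induced q inferInstance := by
      refine (hmin.eq_of_coarser _ (topologicalGroup_induced q) ?_ hqc.le_induced).symm
      let _ : TopologicalSpace H := TopologicalSpace.induced q inferInstance
      exact T2Space.of_injective_continuous hq continuous_induced_dom
    refine hN1 ((Subgroup.eq_bot_iff_forall N).2 fun n hn => ?_)
    -- Elements of `H` approaching `n` in `K` tend to `1` in `K ⧸ N`, hence in `H`, hence in `K`; so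
    -- `n = 1`.
    have hlim : Filter.Tendsto i (Filter.comap i (𝓝 n)) (𝓝 n) := Filter.tendsto_comap
    have hne : (Filter.comap i (𝓝 n)).NeBot := by
      rw [Filter.comap_neBot_iff_frequently]
      exact mem_closure_iff_frequently.1 (hd n)
    have hq1 : Filter.Tendsto q (Filter.comap i (𝓝 n)) (𝓝 (q 1)) := by
      have h := ((continuous_quot_mk (X := K) (r := (QuotientGroup.leftRel N).r)).tendsto n).comp
        hlim
      have hn1 : (QuotientGroup.mk n : K ⧸ N) = q 1 := by
        rw [map_one]
        exact (QuotientGroup.eq_one_iff n).2 hn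
      rw [← hn1]
      exact h
    have h1 : Filter.Tendsto id (Filter.comap i (𝓝 n)) (𝓝 (1 : H)) :=
      (IsInducing.tendsto_nhds_iff ⟨hqe⟩).2 hq1
    have h2 := (hi.continuous.tendsto 1).comp h1
    rw [map_one] at h2
    exact tendsto_nhds_unique hlim h2
  · intro hess
    have hclos : ∀ (U : Set H) (h : H), IsClosed U → i h ∈ closure (i '' U) → h ∈ U := by
      intro U h hU hh
      rwa [← hU.closure_eq, hi.isInducing.closure_eq_preimage_closure_image]
    have hnhds : ∀ S ∈ 𝓝 (1 : H), ∃ W ∈ 𝓝 (1 : K), i ⁻¹' W ⊆ S := by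
      intro S hS
      rwa [hi.isInducing.nhds_eq_comap, map_one] at hS
    refine ⟨hH, hi.t2Space, fun σ hσ hσ2 hle => ?_⟩
    -- The core misses every `i h` with `h ≠ 1`: some `σ`-closed neighbourhood of `1` omits `h`, and
    -- it is also `τ`-closed.
    have hbot : i.nhdsCore σ hσ = ⊥ := by
      by_contra hne
      refine hess _ (i.normal_nhdsCore σ hσ hd) (i.isClosed_nhdsCore σ hσ) hne ?_
      refine (Subgroup.eq_bot_iff_forall _).2 ?_
      rintro _ ⟨⟨h, rfl⟩, hh⟩
      have h1 : h = 1 := by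
        by_contra hne1
        obtain ⟨U, hU, hUc, hhU⟩ := @exists_isClosed_mem_nhds_one_notMem H _ σ hσ hσ2 h hne1
        exact hhU (hclos U h (hUc.mono hle) (hh U hU))
      rw [h1, map_one]
    refine IsTopologicalGroup.ext hσ hH (le_antisymm ?_ (nhds_mono hle))
    intro S hS
    obtain ⟨W, hW, hWS⟩ := hnhds S hS
    obtain ⟨W', hW'W, hW'o, hW'1⟩ := mem_nhds_iff.1 hW
    let U₀ := {U // U ∈ @nhds H σ 1}
    -- The directed family of compact closures has intersection `{1}`, so a single closure already
    -- lies in `W`.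
    have hinter : ⋂ U : U₀, closure (i '' U.1) ⊆ W' := by
      intro x hx
      have hx' : x ∈ i.nhdsCore σ hσ := fun U hU => Set.mem_iInter.1 hx ⟨U, hU⟩
      rw [hbot, Subgroup.mem_bot] at hx'
      rwa [hx']
    have : Nonempty U₀ := ⟨⟨Set.univ, Filter.univ_mem⟩⟩
    obtain ⟨U, hU⟩ := exists_subset_nhds_of_isCompact' (V := fun U : U₀ => closure (i '' U.1))
      (fun U V => ⟨⟨U.1 ∩ V.1, Filter.inter_mem U.2 V.2⟩,
        closure_mono (Set.image_mono Set.inter_subset_left),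
        closure_mono (Set.image_mono Set.inter_subset_right)⟩)
      (fun _ => isClosed_closure.isCompact) (fun _ => isClosed_closure)
      (fun x hx => hW'o.mem_nhds (hinter hx))
    exact Filter.mem_of_superset U.2 fun u hu =>
      hWS (hW'W (hU (subset_closure ⟨u, hu, rfl⟩)))

end MinimalityCriterion

/-! ### Untwisting the semidirect product. -/

namespace TopAut

variable {G : Type*} [Group G] [TopologicalSpace G]

theorem t2Space [T2Space G] : T2Space (G ≃ₜ* G) :=
  T2Space.of_injective_continuous (f := toCMap)
    (fun _ _ h => ContinuousMulEquiv.ext fun x => DFunLike.congr_fun h x) continuous_toCMap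

theorem continuous_conj [IsTopologicalGroup G] : Continuous (conj : G →* (G ≃ₜ* G)) := by
  refine continuous_induced_rng.2 (ContinuousMap.continuous_of_continuous_uncurry _ ?_)
  change Continuous fun p : G × G => p.1 * p.2 * p.1⁻¹
  fun_prop

theorem conj_injective [IsTopologicalGroup G] (hZ : Subgroup.center G = ⊥) :
    Function.Injective (conj : G →* (G ≃ₜ* G)) := by
  refine (injective_iff_map_eq_one _).2 fun g hg => ?_
  rw [← Subgroup.mem_bot, ← hZ, Subgroup.mem_center_iff]
  intro x
  have h : g * x * g⁻¹ = x := DFunLike.congr_fun hg x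
  exact (mul_inv_eq_iff_eq_mul.1 h).symm

variable [IsTopologicalGroup G] [CompactSpace G] [T2Space G]

theorem topologicalClosure_le_Inn {P : Subgroup (G ≃ₜ* G)} (hP : P ≤ Inn G) :
    P.topologicalClosure ≤ Inn G := by
  have := t2Space (G := G)
  refine P.topologicalClosure_minimal hP ?_
  have h : (Inn G : Set (G ≃ₜ* G)) = Set.range conj := MonoidHom.coe_range _
  rw [h]
  exact (isCompact_range continuous_conj).isClosed

/-- For a centerless compact group, inner automorphisms depend continuously on, and determine
continuously, the conjugating element. -/
theorem exists_continuous_section_conj (hZ : Subgroup.center G = ⊥) {Q : Subgroup (G ≃ₜ* G)}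
    (hQ : Q ≤ Inn G) : ∃ s : Q →* G, Continuous s ∧ ∀ f, conj (s f) = f := by
  have := t2Space (G := G)
  have hinj := conj_injective hZ
  -- A continuous injection from a compact space to a Hausdorff one is an embedding, so continuity
  -- of `t` can be tested after applying `conj`.
  have hemb : IsEmbedding (conj : G →* (G ≃ₜ* G)) :=
    (continuous_conj.isClosedEmbedding hinj).isEmbedding
  choose t ht using fun f : Q => hQ f.2
  refine ⟨⟨⟨t, hinj ?_⟩, fun a b => hinj ?_⟩, hemb.continuous_iff.2 ?_, ht⟩
  · rw [ht, map_one]; rfl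
  · change conj (t (a * b)) = conj (t a * t b)
    rw [map_mul, ht, ht, ht]; rfl
  · exact continuous_subtype_val.congr fun f => (ht f).symm

/-- A semidirect product with inner automorphisms is untwisted into a direct product. -/
def untwist (P : Subgroup (G ≃ₜ* G)) (s : P.topologicalClosure →* G)
    (hs : ∀ f, conj (s f) = f) : G ⋊[action P] P →* G × P.topologicalClosure where
  toFun a := (a.left * s (Subgroup.inclusion P.le_topologicalClosure a.right),
    Subgroup.inclusion P.le_topologicalClosure a.right)
  map_one' := by simp
  map_mul' a b := by
    have h : action P a.right b.left =
        s (Subgroup.inclusion P.le_topologicalClosure a.right) * b.left *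
          (s (Subgroup.inclusion P.le_topologicalClosure a.right))⁻¹ := by
      rw [← conj_apply, hs]
      rfl
    refine Prod.ext ?_ ?_
    · simp only [SemidirectProduct.mul_left, SemidirectProduct.mul_right, map_mul, h,
        Prod.mk_mul_mk]
      group
    · simp

/-- The homeomorphism of `G × Q` that multiplies the first coordinate by `s f`. -/
def shear {Q : Subgroup (G ≃ₜ* G)} (s : Q →* G) (hs : Continuous s) : G × Q ≃ₜ G × Q where
  toFun a := (a.1 * s a.2, a.2)
  invFun a := (a.1 * (s a.2)⁻¹, a.2)
  left_inv a := by simp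
  right_inv a := by simp
  continuous_toFun := by fun_prop
  continuous_invFun := by fun_prop

/-- This factorization reduces embedding and density of `untwist` to those of the inclusion of `P`
in its closure. -/
theorem untwist_eq_shear (P : Subgroup (G ≃ₜ* G)) (s : P.topologicalClosure →* G)
    (hs : ∀ f, conj (s f) = f) (hsc : Continuous s) :
    ⇑(untwist P s hs) = shear s hsc ∘
      Prod.map id (Subgroup.inclusion P.le_topologicalClosure) ∘
        fun a : G ⋊[action P] P => (a.left, a.right) := rfl

theorem isEmbedding_untwist (P : Subgroup (G ≃ₜ* G)) (s : P.topologicalClosure →* G)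
    (hs : ∀ f, conj (s f) = f) (hsc : Continuous s) : IsEmbedding (untwist P s hs) := by
  rw [untwist_eq_shear P s hs hsc]
  refine (shear s hsc).isEmbedding.comp ((IsEmbedding.id.prodMap ?_).comp ⟨⟨rfl⟩, ?_⟩)
  · exact IsEmbedding.inclusion P.le_topologicalClosure
  · intro a b h
    exact SemidirectProduct.ext (Prod.mk.inj h).1 (Prod.mk.inj h).2

theorem denseRange_untwist (P : Subgroup (G ≃ₜ* G)) (s : P.topologicalClosure →* G)
    (hs : ∀ f, conj (s f) = f) (hsc : Continuous s) : DenseRange (untwist P s hs) := by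
  rw [untwist_eq_shear P s hs hsc]
  refine (shear s hsc).surjective.denseRange.comp ?_ (shear s hsc).continuous
  have hsurj : Function.Surjective fun a : G ⋊[action P] P => (a.left, a.right) :=
    fun p => ⟨⟨p.1, p.2⟩, rfl⟩
  have hincl : DenseRange (Subgroup.inclusion P.le_topologicalClosure) :=
    denseRange_inclusion_iff P.le_topologicalClosure |>.2 subset_rfl
  exact (denseRange_id.prodMap hincl).comp hsurj.denseRange
    (continuous_id.prodMap (continuous_inclusion P.le_topologicalClosure))

theorem mem_range_untwist (P : Subgroup (G ≃ₜ* G)) (s : P.topologicalClosure →* G)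
    (hs : ∀ f, conj (s f) = f) (a : G × P.topologicalClosure) :
    a ∈ (untwist P s hs).range ↔ (a.2 : G ≃ₜ* G) ∈ P := by
  constructor
  · rintro ⟨b, rfl⟩
    exact b.right.2
  · intro h
    exact ⟨⟨a.1 * (s a.2)⁻¹, ⟨a.2, h⟩⟩,
      Prod.ext (inv_mul_cancel_right a.1 (s a.2)) rfl⟩

end TopAut

/-! ### Essential subgroups of a product with a centerless factor. -/

/-- If `G` is centerless, then `G × L` is essential in `G × K` if and only if `L` is essential
in `K`. -/
theorem Subgroup.isEssential_top_prod_iff {G K : Type*} [Group G] [TopologicalSpace G] [T1Space G]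
    [Group K] [TopologicalSpace K] (hZ : Subgroup.center G = ⊥) (L : Subgroup K) :
    ((⊤ : Subgroup G).prod L).IsEssential ↔ L.IsEssential := by
  constructor
  · intro h N hN hNc hN1 hbot
    have hc : IsClosed (((⊥ : Subgroup G).prod N : Subgroup (G × K)) : Set (G × K)) := by
      rw [Subgroup.coe_prod, Subgroup.coe_bot]
      exact isClosed_singleton.prod hNc
    refine h ((⊥ : Subgroup G).prod N) inferInstance hc ?_ ?_
    · intro h0
      exact hN1 (Subgroup.prod_eq_bot_iff.1 h0).2
    · refine (Subgroup.eq_bot_iff_forall _).2 ?_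
      rintro ⟨g, k⟩ ⟨⟨-, hk⟩, ⟨hg, hk'⟩⟩
      have hkb : k ∈ L ⊓ N := ⟨hk, hk'⟩
      rw [hbot] at hkb
      exact Prod.ext hg hkb
  · intro h N hN hNc hN1 hbot
    have hmem : ∀ a ∈ N, a.2 ∈ L → a = 1 := fun a ha haL => by
      have : a ∈ (⊤ : Subgroup G).prod L ⊓ N := ⟨⟨trivial, haL⟩, ha⟩
      rwa [hbot] at this
    have hfst : ∀ a ∈ N, a.1 = 1 := by
      intro a ha
      rw [← Subgroup.mem_bot, ← hZ, Subgroup.mem_center_iff]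
      intro x
      -- The commutator of `(x, 1)` and `a` has second coordinate `1 ∈ L`, so it is trivial; hence
      -- `a.1` is central.
      have hcomm : ((x, 1) : G × K) * a * (x, 1)⁻¹ * a⁻¹ ∈ N :=
        N.mul_mem (hN.conj_mem a ha _) (N.inv_mem ha)
      have h1 := congrArg Prod.fst (hmem _ hcomm (by simp [L.one_mem]))
      change x * a.1 * x⁻¹ * a.1⁻¹ = 1 at h1
      exact mul_inv_eq_iff_eq_mul.1 (mul_inv_eq_one.1 h1)
    refine h (N.comap (MonoidHom.inr G K)) inferInstance
      (hNc.preimage (Continuous.prodMk_right 1)) ?_ ?_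
    · intro h0
      refine hN1 ((Subgroup.eq_bot_iff_forall _).2 fun a ha => ?_)
      have h2 : a.2 ∈ N.comap (MonoidHom.inr G K) := by
        change (1, a.2) ∈ N
        rwa [← hfst a ha]
      rw [h0] at h2
      exact Prod.ext (hfst a ha) h2
    · refine (Subgroup.eq_bot_iff_forall _).2 ?_
      rintro k ⟨hkL, hkN⟩
      exact congrArg Prod.snd (hmem (1, k) hkN hkL)

theorem mainTheorem7 {G : Type*} [Group G] [TopologicalSpace G] [IsTopologicalGroup G]
    [CompactSpace G] [T2Space G] (hZ : Subgroup.center G = ⊥)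
    (P : Subgroup (G ≃ₜ* G)) (hP : P ≤ TopAut.Inn G) :
    IsMinimalTopologicalGroup (G ⋊[TopAut.action P] P) ↔
      (P.subgroupOf P.topologicalClosure).IsEssential := by
  have := TopAut.t2Space (G := G)
  have hle := TopAut.topologicalClosure_le_Inn hP
  obtain ⟨s, hsc, hs⟩ := TopAut.exists_continuous_section_conj hZ hle
  have : CompactSpace P.topologicalClosure := by
    refine isCompact_iff_compactSpace.1 ((isCompact_range TopAut.continuous_conj).of_isClosed_subset
      P.isClosed_topologicalClosure fun f hf => ?_)
    exact hle hf
  rw [isMinimalTopologicalGroup_iff_isEssential_range (TopAut.untwist P s hs)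
    (TopAut.isEmbedding_untwist P s hs hsc) (TopAut.denseRange_untwist P s hs hsc)]
  have hrange : (TopAut.untwist P s hs).range =
      (⊤ : Subgroup G).prod (P.subgroupOf P.topologicalClosure) := by
    ext a
    rw [TopAut.mem_range_untwist, Subgroup.mem_prod, Subgroup.mem_subgroupOf]
    simp
  rw [hrange, Subgroup.isEssential_top_prod_iff hZ]
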